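/- Let $M$ be a compact metric space and $X=\{X^t\}_{t\in\mathbb R}$ a continuous flow on $M$. A continuum is a (nonempty) compact connected set; $X^I(S)=\{X^t(x): t\in I,\ x\in S\}$. The flow is *cw-expansive* if for every $\epsilon>0$ there is $\delta>0$ such that: whenever $A\subset M$ is a continuum, $\alpha$ assigns to each $x\in A$ a homeomorphism $\alpha(x)$ of $\mathbb R$ fixing $0$, with $x\mapsto\alpha(x)(t)$ continuous on $A$ for every $t$ and $\alpha(p)=\mathrm{id}$ for some $p\in A$, and $\operatorname{diam}\{X^{\alpha(x)(t)}(x):x\in A\}<\delta$ for all $t\in\mathbb R$, then $A\subset X^{(-\epsilon,\epsilon)}(p)$. A closed set $S$ is a *cross-section of time* $\epsilon$ if $S\cap X^{(-\epsilon,\epsilon)}(x)=\{x\}$ for all $x\in S$; put $S^*=\operatorname{int}(X^{(-\epsilon,\epsilon)}(S))\cap S$. Let $\epsilon,\delta>0$. A *$\delta$-adequate pair* $(\mathcal S,\mathcal T)$ consists of finite families $S_1,\dots,S_k$, $T_1,\dots,T_k$ of cross-sections of time $\epsilon$ and diameter at most $\delta$ with $T_i\subset S_i^*$ and $M=\bigcup_iX^{[0,\epsilon]}(T_i)=\bigcup_iX^{[-\epsilon,0]}(T_i)=\bigcup_iX^{[0,\epsilon]}(S_i)=\bigcup_iX^{[-\epsilon,0]}(S_i)$.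 Let $\theta=\sup\{d>0:\ X^{(0,d)}(x)\cap\bigcup_iS_i=\emptyset\ \ \forall x\in\bigcup_iS_i\}$ ($\theta=0$ if there is no such $d$). Let $\rho>0$ with $5\rho<\epsilon$, $2\rho<\theta$, put $D^i_\rho=X^{(-\rho,\rho)}(S_i)$, and let $P^i_\rho:D^i_\rho\to S_i$ be the projection $P_\rho^i(x)=X^s(x)\in S_i$, $|s|<\rho$. Let $0<\epsilon_0<\theta/2$ be such that if $x,y\in S_i$, $d(x,y)<\epsilon_0$, $|t|\le\epsilon$ and $X^t(x)\in T_j$, then $X^t(y)\in D^j_\rho$. For $x\in\bigcup_iS_i$ let $\phi(x)=X^{t}(x)$, where $t=t(x)>0$ is the smallest positive time with $X^t(x)\in\bigcup_iT_i$. For $x\in A\subset S_j$ put $\phi^0(A,x)=A$, and, as long as $\operatorname{diam}\phi^n(A,x)<\epsilon_0$, let $\phi^{n+1}(A,x)=P^l_\rho\big(X^{t}(\phi^n(A,x))\big)$ with $t=t(\phi^n(x))$ and $\phi^{n+1}(x)\in T_l$ (the result does not depend on $l$). For $n<0$, $\phi^{n}(A,x)$ is defined in the same way going backwards along orbits. For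 $0<\eta<\epsilon_0$ let $W^s_\eta(\mathcal S,\mathcal T)$ (respectively $W^u_\eta(\mathcal S,\mathcal T)$) be the set of continua $A$ for which there is $x\in A$ such that $\phi^n(A,x)$ is defined and $\operatorname{diam}\phi^n(A,x)<\eta$ for all $n\ge0$ (respectively all $n\le 0$). **Theorem.** Let $X$ be cw-expansive, and let $(\mathcal S,\mathcal T)$, $\rho$, $\epsilon_0$ be as above. Then there is $\eta_0\in(0,\epsilon_0]$ such that for every $0<\eta<\eta_0$: (a) if $A\in W^s_\eta(\mathcal S,\mathcal T)$, then for every $x\in A$ the sets $\phi^n(A,x)$ are defined for all $n\ge0$ and $\operatorname{diam}\phi^n(A,x)\to0$ as $n\to+\infty$; (b) if $A\in W^u_\eta(\mathcal S,\mathcal T)$, then for every $x\in A$ the sets $\phi^n(A,x)$ are defined for all $n\le0$ and $\operatorname{diam}\phi^n(A,x)\to0$ as $n\to-\infty$. -/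

import Mathlib

open Set Filter Topology

noncomputable section

namespace CWFlow

variable {M : Type*} [MetricSpace M] [CompactSpace M]

/-- The set `X^{(-r,r)}(S)` of all points `X^t(x)` with `x ∈ S` and `|t| < r`. -/
def tube (X : Flow ℝ M) (r : ℝ) (S : Set M) : Set M :=
  image2 (fun t x => X t x) (Ioo (-r) r) S

/-- A family `α : A → Hom(ℝ,0)` of homeomorphisms of the line fixing the origin, pointwise
continuous in `x ∈ A`, with `α(p) = id` for the guide point `p ∈ A`. -/
structure IsReparam {A : Set M} (α : A → ℝ ≃ₜ ℝ) (p : A) : Prop where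
  map_zero : ∀ x : A, α x 0 = 0
  guide : α p = Homeomorph.refl ℝ
  continuous_eval : ∀ t : ℝ, Continuous fun x : A => α x t

/-- The set `{X^{α(x)(t)}(x) : x ∈ A}`. -/
def reparamImage (X : Flow ℝ M) {A : Set M} (α : A → ℝ ≃ₜ ℝ) (t : ℝ) : Set M :=
  range fun x : A => X (α x t) (x : M)

/-- Continuum-wise expansiveness of a flow. -/
def CWExpansive (X : Flow ℝ M) : Prop :=
  ∀ ε : ℝ, 0 < ε → ∃ δ : ℝ, 0 < δ ∧
    ∀ A : Set M, IsCompact A → IsConnected A →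
      ∀ (α : A → ℝ ≃ₜ ℝ) (p : A), IsReparam α p →
        (∀ t : ℝ, Metric.diam (reparamImage X α t) < δ) →
          A ⊆ tube X ε {(p : M)}

/-- Cross-sections of time `ε`. -/
structure IsCrossSection (X : Flow ℝ M) (ε : ℝ) (S : Set M) : Prop where
  isClosed : IsClosed S
  inter_eq : ∀ x ∈ S, S ∩ tube X ε {x} = {x}

/-- The interior `S^*` of a cross-section of time `ε`. -/
def sectionInterior (X : Flow ℝ M) (ε : ℝ) (S : Set M) : Set M :=
  interior (tube X ε S) ∩ S

/-- `δ`-adequate pairs of finite families of cross-sections of time `ε`. -/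
structure IsAdequatePair (X : Flow ℝ M) (ε δ : ℝ) {k : ℕ} (S T : Fin k → Set M) : Prop where
  time_pos : 0 < ε
  diam_pos : 0 < δ
  crossS : ∀ i, IsCrossSection X ε (S i)
  crossT : ∀ i, IsCrossSection X ε (T i)
  diamS : ∀ i, Metric.diam (S i) ≤ δ
  diamT : ∀ i, Metric.diam (T i) ≤ δ
  subset_interior : ∀ i, T i ⊆ sectionInterior X ε (S i)
  cover_fwd_T : ⋃ i, image2 (fun t x => X t x) (Icc 0 ε) (T i) = univ
  cover_bwd_T : ⋃ i, image2 (fun t x => X t x) (Icc (-ε) 0) (T i) = univ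
  cover_fwd_S : ⋃ i, image2 (fun t x => X t x) (Icc 0 ε) (S i) = univ
  cover_bwd_S : ⋃ i, image2 (fun t x => X t x) (Icc (-ε) 0) (S i) = univ

/-- The number `θ`: the supremum of all `d > 0` such that no point of `⋃ S i` meets `⋃ S i`
again during the time interval `(0,d)` (it is `0` if there is no such `d`). -/
def theta (X : Flow ℝ M) {k : ℕ} (S : Fin k → Set M) : ℝ :=
  sSup {d : ℝ | 0 < d ∧ ∀ x ∈ ⋃ i, S i, ∀ t ∈ Ioo 0 d, X t x ∉ ⋃ i, S i}

/-- The conditions on the projection radius `ρ`. -/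
structure IsRadius (X : Flow ℝ M) (ε : ℝ) {k : ℕ} (S : Fin k → Set M) (ρ : ℝ) : Prop where
  pos : 0 < ρ
  lt_time : 5 * ρ < ε
  lt_theta : 2 * ρ < theta X S

/-- The conditions on the size `ε₀`: whenever a point `x` of a section `S i` is carried into some
`T j` in a time of modulus at most `ε` (first-return times lie in this range), all points of `S i`
that are `ε₀`-close to `x` are carried into the tube `X^{(-ρ,ρ)}(S j)` in the same time. -/
structure IsSize (X : Flow ℝ M) (ε : ℝ) {k : ℕ} (S T : Fin k → Set M) (ρ ε₀ : ℝ) : Prop where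
  pos : 0 < ε₀
  lt_theta : ε₀ < theta X S / 2
  mem_tube : ∀ i j, ∀ x ∈ S i, ∀ y ∈ S i, dist x y < ε₀ → ∀ t : ℝ, |t| ≤ ε →
    X t x ∈ T j → X t y ∈ tube X ρ (S j)

/-- The smallest `t > 0` with `X^t(x) ∈ U`. -/
def returnTime (X : Flow ℝ M) (U : Set M) (x : M) : ℝ :=
  sInf {t : ℝ | 0 < t ∧ X t x ∈ U}

/-- The first-return map `x ↦ X^t(x)`, `t = returnTime X U x`. -/
def firstReturn (X : Flow ℝ M) (U : Set M) (x : M) : M :=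
  X (returnTime X U x) x

/-- The image `P_ρ(C)` of `C` under the projection `P_ρ : X^{(-ρ,ρ)}(S) → S` along orbits. -/
def projImage (X : Flow ℝ M) (ρ : ℝ) (S C : Set M) : Set M :=
  {z | z ∈ S ∧ ∃ y ∈ C, ∃ t : ℝ, |t| < ρ ∧ X t y = z}

/-- The forward iterates `φ^n(A,x)`: with `t` the first-return time of `φ^n(x)` to `⋃ T i`
and `l` such that `φ^{n+1}(x) ∈ T l`, one has `φ^{n+1}(A,x) = P_ρ^l(X^t(φ^n(A,x)))`.
(For sets of diameter less than `ε₀` the result does not depend on the choice of `l`.) -/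
def fwdIter (X : Flow ℝ M) {k : ℕ} (S T : Fin k → Set M) (ρ : ℝ) (A : Set M) (x : M) :
    ℕ → Set M
  | 0 => A
  | n + 1 =>
    ⋃ l, ⋃ (_ : (firstReturn X (⋃ i, T i))^[n + 1] x ∈ T l),
      projImage X ρ (S l)
        (X (returnTime X (⋃ i, T i) ((firstReturn X (⋃ i, T i))^[n] x)) ''
          fwdIter X S T ρ A x n)

/-- The iterates `φ^n(A,x)`, `n ∈ ℤ`. The negative ones are obtained by the same construction
going backwards along the orbits, that is, along those of the reversed flow. -/
def iter (X : Flow ℝ M) {k : ℕ} (S T : Fin k → Set M) (ρ : ℝ) (A : Set M) (x : M) :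
    ℤ → Set M
  | Int.ofNat n => fwdIter X S T ρ A x n
  | Int.negSucc n => fwdIter X.reverse S T ρ A x (n + 1)

/-- `φ^n(A,x)` is defined: `x ∈ A ⊆ S j` for some `j`, and every iterate to which the construction
was applied on the way from `0` to `n` has diameter less than `ε₀`. -/
def IterDefined (X : Flow ℝ M) {k : ℕ} (S T : Fin k → Set M) (ρ ε₀ : ℝ) (A : Set M) (x : M)
    (n : ℤ) : Prop :=
  x ∈ A ∧ (∃ j, A ⊆ S j) ∧
    ∀ m : ℤ, (0 ≤ m ∧ m < n) ∨ (n < m ∧ m ≤ 0) → Metric.diam (iter X S T ρ A x m) < ε₀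

/-- The local stable set `W^s_η(S,T)`, a set of continua. -/
def localStable (X : Flow ℝ M) {k : ℕ} (S T : Fin k → Set M) (ρ ε₀ η : ℝ) : Set (Set M) :=
  {A | IsCompact A ∧ IsConnected A ∧ ∃ x ∈ A, ∀ n : ℤ, 0 ≤ n →
    IterDefined X S T ρ ε₀ A x n ∧ Metric.diam (iter X S T ρ A x n) < η}

/-- The local unstable set `W^u_η(S,T)`, a set of continua. -/
def localUnstable (X : Flow ℝ M) {k : ℕ} (S T : Fin k → Set M) (ρ ε₀ η : ℝ) : Set (Set M) :=
  {A | IsCompact A ∧ IsConnected A ∧ ∃ x ∈ A, ∀ n : ℤ, n ≤ 0 →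
    IterDefined X S T ρ ε₀ A x n ∧ Metric.diam (iter X S T ρ A x n) < η}

end CWFlow

end

/-! Write `U = ⋃ S i` and `V = ⋃ T i`. Orbits meet `U` at times at least `θ > 2ρ` apart, so
projecting to `S l` along time less than `ρ` is the same as projecting to `U`. The iterate
`φ^n(A,x)` is therefore the set of points `X^{β n a}(a)`, `a ∈ A`, for continuous times `β n`
(`fwdIter_eq`). When the iterates are small, compactness makes the gaps `β (n+1) a - β n a` nearly
independent of `a` (`exists_isSynchronised`).

Suppose the diameters do not tend to `0`. Recentre each iterate at its own index: pair the point
`X^{σ_n(a)}(a)` with the sequence `m ↦ σ_{n+m}(a) - σ_n(a)`, in a compact subset of `M × (ℤ → ℝ)`. A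
limit along an ultrafilter of indices with large diameter is a continuum whose points stay close in
`U` at all integer indices, negative ones included. Transversality makes the time sequence a
function of the point, continuous by compactness. Interpolating linearly gives reparametrisations,
and cw-expansiveness puts the projected continuum in an orbit segment of time less than `ρ`. Such a
segment cannot contain two points of `U`, yet the limit is nondegenerate (`tendsto_diam`).

For another guide `y ∈ A` the first returns may occur at quite different moments, so its times are
compared with the interpolated times of the first guide at a real index. Each projection corrects
the error, which therefore does not accumulate (`exists_diam_fwdIter_lt`). The unstable case is the
stable one for the reversed flow. -/

noncomputable section

namespace CWFlow

/-! ### Transversals, first returns and projection times. -/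

section

variable {M : Type*} [MetricSpace M]

/-- A closed set `U` that orbits meet at times at least `θ` apart, and a closed subset `V` that
every orbit meets within time `ε`. -/
structure IsTransversal (X : Flow ℝ M) (ε θ ρ : ℝ) (U V : Set M) : Prop where
  isClosed : IsClosed U
  isClosed_sub : IsClosed V
  subset : V ⊆ U
  eq_zero : ∀ x ∈ U, ∀ t : ℝ, |t| < θ → X t x ∈ U → t = 0
  pos : 0 < ρ
  lt_theta : 2 * ρ < θ
  hits : ∀ x, ∃ t ∈ Icc 0 ε, X t x ∈ V

section Flow

variable {X : Flow ℝ M} {ε θ ρ : ℝ} {U V : Set M}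

lemma IsTransversal.theta_pos (h : IsTransversal X ε θ ρ U V) : 0 < θ := by
  linarith [h.pos, h.lt_theta]

lemma IsTransversal.eq_of_mem (h : IsTransversal X ε θ ρ U V) {y : M} {s t : ℝ}
    (hs : X s y ∈ U) (ht : X t y ∈ U) (hst : |s - t| < θ) : s = t := by
  have := h.eq_zero _ ht (s - t) hst (by rwa [← X.map_add, sub_add_cancel])
  linarith

/-- Positive hitting times are at least `θ`, so they form a closed set and the infimum is attained.
Since `hits` may return time `0`, it is applied at `X d x` with `d → 0` to get the bound `ε`. -/
lemma IsTransversal.returnTime_spec (h : IsTransversal X ε θ ρ U V) {x : M} (hx : x ∈ U) :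
    returnTime X V x ∈ Icc θ ε ∧ X (returnTime X V x) x ∈ V := by
  have hge : ∀ t : ℝ, 0 < t → X t x ∈ V → θ ≤ t := by
    intro t ht htV
    by_contra! hlt
    exact ht.ne' (h.eq_zero x hx t (by rwa [abs_of_pos ht]) (h.subset htV))
  have heq : {t : ℝ | 0 < t ∧ X t x ∈ V} = Ici θ ∩ (fun t => X t x) ⁻¹' V := by
    ext t
    exact ⟨fun ht => ⟨hge t ht.1 ht.2, ht.2⟩, fun ht => ⟨h.theta_pos.trans_le ht.1, ht.2⟩⟩
  have hcl : IsClosed {t : ℝ | 0 < t ∧ X t x ∈ V} := by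
    rw [heq]
    exact isClosed_Ici.inter (h.isClosed_sub.preimage (by fun_prop))
  have hbdd : BddBelow {t : ℝ | 0 < t ∧ X t x ∈ V} := ⟨0, fun t ht => ht.1.le⟩
  have hex : ∀ d > 0, ∃ t ∈ {t : ℝ | 0 < t ∧ X t x ∈ V}, t ≤ ε + d := by
    intro d hd
    obtain ⟨s, hs, hsV⟩ := h.hits (X d x)
    rw [← X.map_add] at hsV
    exact ⟨s + d, ⟨by linarith [hs.1], hsV⟩, by linarith [hs.2]⟩
  obtain ⟨t₀, ht₀, -⟩ := hex 1 one_pos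
  have hmem := hcl.csInf_mem ⟨t₀, ht₀⟩ hbdd
  refine ⟨⟨hge _ hmem.1 hmem.2, ?_⟩, hmem.2⟩
  refine le_of_forall_pos_le_add fun d hd => ?_
  obtain ⟨t, ht, htle⟩ := hex d hd
  exact (csInf_le hbdd ht).trans htle

lemma IsTransversal.iterate_mem (h : IsTransversal X ε θ ρ U V) {x : M} (hx : x ∈ U) (n : ℕ) :
    (firstReturn X V)^[n] x ∈ U := by
  induction n with
  | zero => exact hx
  | succ n ih =>
    rw [Function.iterate_succ_apply']
    exact h.subset (h.returnTime_spec ih).2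

open Classical in
/-- The time of modulus less than `ρ` at which the orbit of `y` meets `U` (`0` if there is none). -/
def projTime (X : Flow ℝ M) (ρ : ℝ) (U : Set M) (y : M) : ℝ :=
  if h : ∃ t : ℝ, |t| < ρ ∧ X t y ∈ U then h.choose else 0

lemma projTime_spec {y : M} (h : ∃ t : ℝ, |t| < ρ ∧ X t y ∈ U) :
    |projTime X ρ U y| < ρ ∧ X (projTime X ρ U y) y ∈ U := by
  rw [projTime, dif_pos h]
  exact h.choose_spec

lemma IsTransversal.projTime_eq (h : IsTransversal X ε θ ρ U V) {y : M} {t : ℝ} (ht : |t| < ρ)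
    (hty : X t y ∈ U) : projTime X ρ U y = t := by
  obtain ⟨h1, h2⟩ := projTime_spec ⟨t, ht, hty⟩
  refine h.eq_of_mem h2 hty ?_
  have := abs_sub (projTime X ρ U y) t
  linarith [h.lt_theta]

/-- The time at which the orbit of `a` reaches the `n`-th iterate of the set guided by `x`. -/
def trackTime (X : Flow ℝ M) (ρ : ℝ) (U V : Set M) (x : M) : ℕ → M → ℝ
  | 0, _ => 0
  | n + 1, a => trackTime X ρ U V x n a + returnTime X V ((firstReturn X V)^[n] x) +
      projTime X ρ U
        (X (trackTime X ρ U V x n a + returnTime X V ((firstReturn X V)^[n] x)) a)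

lemma IsTransversal.trackTime_self (h : IsTransversal X ε θ ρ U V) {x : M} (hx : x ∈ U) (n : ℕ) :
    X (trackTime X ρ U V x n x) x = (firstReturn X V)^[n] x ∧
      trackTime X ρ U V x (n + 1) x =
        trackTime X ρ U V x n x + returnTime X V ((firstReturn X V)^[n] x) := by
  have key : ∀ n, X (trackTime X ρ U V x n x) x = (firstReturn X V)^[n] x →
      trackTime X ρ U V x (n + 1) x =
        trackTime X ρ U V x n x + returnTime X V ((firstReturn X V)^[n] x) := by
    intro n hn
    rw [trackTime, h.projTime_eq (t := 0) (by simpa using h.pos), add_zero]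
    rw [X.map_zero_apply, add_comm, X.map_add, hn]
    exact h.subset (h.returnTime_spec (h.iterate_mem hx n)).2
  induction n with
  | zero =>
    have h0 : X (trackTime X ρ U V x 0 x) x = (firstReturn X V)^[0] x := X.map_zero_apply x
    exact ⟨h0, key 0 h0⟩
  | succ n ih =>
    have h1 : X (trackTime X ρ U V x (n + 1) x) x = (firstReturn X V)^[n + 1] x := by
      rw [ih.2, add_comm, X.map_add, ih.1, Function.iterate_succ_apply']
      rfl
    exact ⟨h1, key _ h1⟩

variable [CompactSpace M]

lemma exists_dist_flow_lt (X : Flow ℝ M) (R : ℝ) {κ : ℝ} (hκ : 0 < κ) :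
    ∃ η > 0, ∀ (p q : M) (s t : ℝ), |s| ≤ R → |t| ≤ R → dist p q < η → |s - t| < η →
      dist (X s p) (X t q) < κ := by
  have hc : IsCompact ((Icc (-R) R) ×ˢ (univ : Set M)) := isCompact_Icc.prod isCompact_univ
  have hu := hc.uniformContinuousOn_of_continuous (f := fun z : ℝ × M => X z.1 z.2)
    (by fun_prop)
  obtain ⟨η, hη, h⟩ := Metric.uniformContinuousOn_iff.1 hu κ hκ
  refine ⟨η, hη, fun p q s t hs ht hpq hst => ?_⟩
  refine h (s, p) ⟨abs_le.1 hs, mem_univ _⟩ (t, q) ⟨abs_le.1 ht, mem_univ _⟩ ?_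
  rw [Prod.dist_eq, Real.dist_eq]
  exact max_lt hst hpq

/-- On the compact set of triples violating the conclusion the distance is positive: `p = q` would
give two visits to `U` less than `θ` apart. This turns an a priori bound `2ρ` on a time into an
arbitrarily small one. -/
lemma IsTransversal.exists_small_return (h : IsTransversal X ε θ ρ U V) {κ : ℝ} (hκ : 0 < κ) :
    ∃ η > 0, ∀ p ∈ U, ∀ (q : M) (u : ℝ), dist p q < η → |u| ≤ 2 * ρ → X u q ∈ U → |u| < κ := by
  have hcl : IsClosed {z : M × M × ℝ | z.1 ∈ U ∧ X z.2.2 z.2.1 ∈ U ∧ κ ≤ |z.2.2|} := by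
    refine (h.isClosed.preimage continuous_fst).inter
      ((h.isClosed.preimage (f := fun z : M × M × ℝ => X z.2.2 z.2.1) (by fun_prop)).inter
        (isClosed_le continuous_const (g := fun z : M × M × ℝ => |z.2.2|) (by fun_prop)))
  have hc : IsCompact (((univ : Set M) ×ˢ (univ : Set M) ×ˢ Icc (-(2 * ρ)) (2 * ρ)) ∩
      {z : M × M × ℝ | z.1 ∈ U ∧ X z.2.2 z.2.1 ∈ U ∧ κ ≤ |z.2.2|}) :=
    (isCompact_univ.prod (isCompact_univ.prod isCompact_Icc)).inter_right hcl
  obtain ⟨η, hη, hle⟩ := hc.exists_forall_le' (f := fun z => dist z.1 z.2.1) (a := 0)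
    (by fun_prop) (by
      rintro ⟨p, q, u⟩ ⟨⟨-, -, hu⟩, hp, hq, hκu⟩
      dsimp only at hu hp hq hκu ⊢
      refine dist_pos.2 ?_
      rintro rfl
      have := h.eq_zero p hp u ((abs_le.2 hu).trans_lt h.lt_theta) hq
      rw [this, abs_zero] at hκu
      linarith)
  refine ⟨η, hη, fun p hp q u hpq hu hq => ?_⟩
  by_contra! hcon
  exact absurd (hle (p, q, u) ⟨⟨mem_univ _, mem_univ _, abs_le.1 hu⟩, hp, hq, hcon⟩)
    (not_le.2 hpq)

lemma IsTransversal.continuousOn_projTime (h : IsTransversal X ε θ ρ U V) :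
    ContinuousOn (projTime X ρ U) {y | ∃ t : ℝ, |t| < ρ ∧ X t y ∈ U} := by
  intro y hy
  rw [ContinuousWithinAt, Metric.tendsto_nhds]
  intro κ hκ
  obtain ⟨h1, h2⟩ := projTime_spec hy
  obtain ⟨η, hη, hsm⟩ := h.exists_small_return hκ
  have hc : ContinuousAt (fun z => X (projTime X ρ U y) z) y := by fun_prop
  filter_upwards [nhdsWithin_le_nhds (hc.eventually (Metric.ball_mem_nhds _ hη)),
    self_mem_nhdsWithin] with z hz hzD
  obtain ⟨h3, h4⟩ := projTime_spec hzD
  rw [Real.dist_eq]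
  refine hsm _ h2 (X (projTime X ρ U y) z) _ (by rw [dist_comm]; exact hz) ?_ ?_
  · have := abs_sub (projTime X ρ U z) (projTime X ρ U y)
    linarith
  · rwa [← X.map_add, sub_add_cancel]

end Flow

/-! ### Iterates of a set as images under the tracking times. -/

section Iter

variable [CompactSpace M] {X : Flow ℝ M} {ε θ ρ ε₀ : ℝ} {k : ℕ} {S T : Fin k → Set M} {A : Set M} {x : M}

/-- The points of the iterates of `A` guided by `x` and the times at which they are reached. -/
lemma IsTransversal.fwdIter_eq (h : IsTransversal X ε θ ρ (⋃ i, S i) (⋃ i, T i))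
    (hs : ∀ i j, ∀ x ∈ S i, ∀ y ∈ S i, dist x y < ε₀ → ∀ t : ℝ, |t| ≤ ε →
      X t x ∈ T j → X t y ∈ tube X ρ (S j))
    (hxA : x ∈ A) (hAS : ∃ j, A ⊆ S j) (n : ℕ)
    (hd : ∀ m < n, Metric.diam (fwdIter X S T ρ A x m) < ε₀) :
    fwdIter X S T ρ A x n = (fun a => X (trackTime X ρ (⋃ i, S i) (⋃ i, T i) x n a) a) '' A ∧
      (∃ j, fwdIter X S T ρ A x n ⊆ S j) ∧
      ContinuousOn (trackTime X ρ (⋃ i, S i) (⋃ i, T i) x n) A ∧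
      ∀ m < n, ∀ a ∈ A, |trackTime X ρ (⋃ i, S i) (⋃ i, T i) x (m + 1) a -
        trackTime X ρ (⋃ i, S i) (⋃ i, T i) x m a -
          returnTime X (⋃ i, T i) ((firstReturn X (⋃ i, T i))^[m] x)| < ρ := by
  have hxU : x ∈ ⋃ i, S i := by
    obtain ⟨j, hj⟩ := hAS
    exact mem_iUnion.2 ⟨j, hj hxA⟩
  induction n with
  | zero =>
    refine ⟨?_, hAS, continuousOn_const, by simp⟩
    simp [fwdIter, trackTime]
  | succ n ih =>
    obtain ⟨him, ⟨i, hi⟩, hcont, hgap⟩ := ih fun m hm => hd m (hm.trans n.lt_succ_self)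
    set U := ⋃ i, S i with hU
    set V := ⋃ i, T i with hV
    set β := trackTime X ρ U V x with hβ
    set xn := (firstReturn X V)^[n] x with hxn
    set τ := returnTime X V xn with hτ
    have hself := h.trackTime_self hxU n
    have hxnU : xn ∈ U := h.iterate_mem hxU n
    obtain ⟨hτm, hτV⟩ := h.returnTime_spec hxnU
    have hxnA : xn ∈ fwdIter X S T ρ A x n := by
      rw [him]
      exact ⟨x, hxA, hself.1⟩
    have hclose : ∀ y ∈ fwdIter X S T ρ A x n, dist xn y < ε₀ := fun y hy =>
      (Metric.dist_le_diam_of_mem Metric.isBounded_of_compactSpace hxnA hy).trans_lt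
        (hd n n.lt_succ_self)
    have hτabs : |τ| ≤ ε := by
      rw [abs_of_nonneg (h.theta_pos.le.trans hτm.1)]
      exact hτm.2
    have hproj : ∀ l, X τ xn ∈ T l → ∀ y ∈ fwdIter X S T ρ A x n,
        ∃ t, |t| < ρ ∧ X t (X τ y) ∈ S l := by
      intro l hl y hy
      obtain ⟨s, hsρ, w, hw, hsw⟩ := hs i l xn (hi hxnA) y (hi hy) (hclose y hy) τ hτabs hl
      refine ⟨-s, by rw [abs_neg]; exact abs_lt.2 hsρ, ?_⟩
      dsimp only at hsw
      rw [← hsw, ← X.map_add, neg_add_cancel, X.map_zero_apply]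
      exact hw
    obtain ⟨l₀, hl₀⟩ := mem_iUnion.1 hτV
    have hsucc : (firstReturn X V)^[n + 1] x = X τ xn := by
      rw [Function.iterate_succ_apply']
      rfl
    have hex : ∀ a ∈ A, ∃ t, |t| < ρ ∧ X t (X (β n a + τ) a) ∈ U := by
      intro a ha
      obtain ⟨t, ht, htS⟩ := hproj l₀ hl₀ (X (β n a) a) (by rw [him]; exact ⟨a, ha, rfl⟩)
      refine ⟨t, ht, mem_iUnion.2 ⟨l₀, ?_⟩⟩
      rwa [add_comm, X.map_add]
    -- The projection time to `S l` is the one to `U`, so every admissible `l` yields the same set.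
    have hstep : ∀ l, X τ xn ∈ T l →
        projImage X ρ (S l) (X τ '' fwdIter X S T ρ A x n) =
          (fun a => X (β (n + 1) a) a) '' A := by
      intro l hl
      ext z
      constructor
      · rintro ⟨hz, _, ⟨y, hy, rfl⟩, t, ht, rfl⟩
        have hy' := hy
        rw [him] at hy'
        obtain ⟨a, ha, rfl⟩ := hy'
        refine ⟨a, ha, ?_⟩
        have : β (n + 1) a = β n a + τ + t := by
          have hpt : projTime X ρ U (X (β n a + τ) a) = t := h.projTime_eq ht (by
            rw [add_comm (β n a), X.map_add]
            exact mem_iUnion.2 ⟨l, hz⟩)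
          rw [← hpt]
          rfl
        dsimp only
        rw [this, add_comm, X.map_add, add_comm (β n a), X.map_add]
      · rintro ⟨a, ha, rfl⟩
        have hy : X (β n a) a ∈ fwdIter X S T ρ A x n := by
          rw [him]
          exact ⟨a, ha, rfl⟩
        obtain ⟨t, ht, htS⟩ := hproj l hl _ hy
        have : β (n + 1) a = β n a + τ + t := by
          have hpt : projTime X ρ U (X (β n a + τ) a) = t := h.projTime_eq ht (by
            rw [add_comm (β n a), X.map_add]
            exact mem_iUnion.2 ⟨l, htS⟩)
          rw [← hpt]
          rfl
        have heq : X (β (n + 1) a) a = X t (X τ (X (β n a) a)) := by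
          rw [this, add_comm, X.map_add, add_comm (β n a), X.map_add]
        dsimp only
        rw [heq]
        exact ⟨htS, _, ⟨_, hy, rfl⟩, t, ht, rfl⟩
    have hmain : fwdIter X S T ρ A x (n + 1) = (fun a => X (β (n + 1) a) a) '' A := by
      rw [fwdIter, ← hV, hsucc]
      apply Subset.antisymm
      · exact iUnion₂_subset fun l hl => (hstep l hl).subset
      · rw [← hstep l₀ hl₀]
        exact subset_iUnion₂_of_subset l₀ hl₀ Subset.rfl
    refine ⟨hmain, ⟨l₀, ?_⟩, ?_, ?_⟩
    · rw [hmain, ← hstep l₀ hl₀]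
      exact fun z hz => hz.1
    · have h1 : ContinuousOn (fun a => β n a + τ) A := hcont.add continuousOn_const
      have h2 : ContinuousOn (fun a => X (β n a + τ) a) A :=
        X.cont'.comp_continuousOn (h1.prodMk continuousOn_id)
      exact h1.add (h.continuousOn_projTime.comp h2 hex)
    · intro m hm a ha
      rcases Nat.lt_succ_iff_lt_or_eq.1 hm with hm | rfl
      · exact hgap m hm a ha
      · have : β (m + 1) a - β m a - τ = projTime X ρ U (X (β m a + τ) a) := by
          have : β (m + 1) a = β m a + τ + projTime X ρ U (X (β m a + τ) a) := rfl
          linarith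
        rw [this]
        exact (projTime_spec (hex a ha)).1

end Iter

end

/-! ### Piecewise linear time changes. -/

section

/-- The piecewise linear interpolation of a sequence `σ : ℤ → ℝ`. -/
def interp (σ : ℤ → ℝ) (r : ℝ) : ℝ := σ ⌊r⌋ + Int.fract r * (σ (⌊r⌋ + 1) - σ ⌊r⌋)

lemma interp_intCast (σ : ℤ → ℝ) (m : ℤ) : interp σ m = σ m := by simp [interp]

lemma monotone_interp {σ : ℤ → ℝ} (h : ∀ m, σ m ≤ σ (m + 1)) : Monotone (interp σ) := by
  have hσ : Monotone σ := monotone_int_of_le_succ h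
  have hlow : ∀ r, σ ⌊r⌋ ≤ interp σ r := fun r =>
    le_add_of_nonneg_right (mul_nonneg (Int.fract_nonneg r) (sub_nonneg.2 (h _)))
  have hup : ∀ r, interp σ r ≤ σ (⌊r⌋ + 1) := fun r => by
    have := mul_le_of_le_one_left (sub_nonneg.2 (h ⌊r⌋)) (Int.fract_lt_one r).le
    rw [interp]
    linarith
  intro r r' hr
  rcases (Int.floor_mono hr).eq_or_lt with he | hlt
  · have hf : Int.fract r ≤ Int.fract r' := by
      rw [Int.fract, Int.fract, he]
      linarith
    rw [interp, interp, ← he]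
    have := mul_le_mul_of_nonneg_right hf (sub_nonneg.2 (h ⌊r⌋))
    linarith
  · exact (hup r).trans ((hσ (Int.add_one_le_of_lt hlt)).trans (hlow r'))

/-- Interpolation is linear in `σ` and exact on `m ↦ c * m`; subtracting this progression reduces
the bound to monotonicity. -/
lemma mul_sub_le_interp_sub {σ : ℤ → ℝ} {c : ℝ} (h : ∀ m, c ≤ σ (m + 1) - σ m) {r r' : ℝ}
    (hr : r ≤ r') : c * (r' - r) ≤ interp σ r' - interp σ r := by
  have hm := monotone_interp (σ := fun m => σ m - c * m) (fun m => by
    have := h m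
    push_cast
    linarith) hr
  have heq : ∀ s, interp (fun m => σ m - c * m) s = interp σ s - c * s := by
    intro s
    have := Int.floor_add_fract s
    simp only [interp]
    push_cast
    linear_combination -c * this
  rw [heq, heq] at hm
  linarith

lemma abs_interp_sub_le {σ σ' : ℤ → ℝ} {κ : ℝ}
    (h : ∀ m, |(σ (m + 1) - σ m) - (σ' (m + 1) - σ' m)| ≤ κ) {r r' : ℝ} (hr : r ≤ r') :
    |(interp σ r' - interp σ r) - (interp σ' r' - interp σ' r)| ≤ κ * (r' - r) := by
  have heq : ∀ (ξ ξ' : ℤ → ℝ) s, interp (fun m => ξ m - ξ' m) s = interp ξ s - interp ξ' s := by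
    intro ξ ξ' s
    simp only [interp]
    ring
  have h1 := mul_sub_le_interp_sub (σ := fun m => σ m - σ' m) (c := -κ) (fun m => by
    linarith [(abs_le.1 (h m)).1]) hr
  have h2 := mul_sub_le_interp_sub (σ := fun m => σ' m - σ m) (c := -κ) (fun m => by
    linarith [(abs_le.1 (h m)).2]) hr
  rw [heq, heq] at h1 h2
  rw [abs_le]
  constructor <;> linarith

lemma strictMono_interp {σ : ℤ → ℝ} {c : ℝ} (hc : 0 < c) (h : ∀ m, c ≤ σ (m + 1) - σ m) :
    StrictMono (interp σ) := fun r r' hr => by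
  have := mul_sub_le_interp_sub h hr.le
  have := mul_pos hc (sub_pos.2 hr)
  linarith

lemma surjective_interp {σ : ℤ → ℝ} {c : ℝ} (hc : 0 < c) (h : ∀ m, c ≤ σ (m + 1) - σ m) :
    Function.Surjective (interp σ) := by
  intro t
  have hmono := strictMono_interp hc h
  obtain ⟨N, hN⟩ := exists_nat_gt (|t - σ 0| / c)
  rw [div_lt_iff₀ hc] at hN
  have h0 : interp σ 0 = σ 0 := by simpa using interp_intCast σ 0
  have hbd : ∀ m : ℤ, σ m ≤ t → m ≤ N := by
    intro m hm
    by_contra! hlt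
    have hle : ((N : ℤ) : ℝ) ≤ (m : ℝ) := by exact_mod_cast hlt.le
    have h1 := hmono.monotone hle
    rw [interp_intCast, interp_intCast] at h1
    have h2 := mul_sub_le_interp_sub h (r := 0) (r' := ((N : ℤ) : ℝ)) (by simp)
    rw [interp_intCast, h0] at h2
    push_cast at h2
    have := le_abs_self (t - σ 0)
    linarith
  have hex : ∃ m : ℤ, σ m ≤ t := by
    refine ⟨-N, ?_⟩
    have h2 := mul_sub_le_interp_sub h (r := ((-N : ℤ) : ℝ)) (r' := 0) (by simp)
    rw [interp_intCast, h0] at h2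
    push_cast at h2
    have := neg_abs_le (t - σ 0)
    linarith
  obtain ⟨m, hm, hmax⟩ := Int.exists_greatest_of_bdd ⟨N, hbd⟩ hex
  have hlt : t < σ (m + 1) := by
    by_contra! hle
    have := hmax _ hle
    omega
  have hg : 0 < σ (m + 1) - σ m := hc.trans_le (h m)
  set f := (t - σ m) / (σ (m + 1) - σ m) with hf
  have hf0 : 0 ≤ f := div_nonneg (by linarith) hg.le
  have hf1 : f < 1 := (div_lt_one hg).2 (by linarith)
  refine ⟨m + f, ?_⟩
  have hfl : ⌊(m : ℝ) + f⌋ = m := by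
    rw [Int.floor_intCast_add, Int.floor_eq_zero_iff.2 ⟨hf0, hf1⟩, add_zero]
  have hfr : Int.fract ((m : ℝ) + f) = f := by
    rw [Int.fract, hfl]
    ring
  rw [interp, hfl, hfr, hf, div_mul_cancel₀ _ hg.ne']
  ring

/-- The piecewise linear homeomorphism interpolating a sequence with gaps bounded below. -/
def interpHomeo (σ : ℤ → ℝ) {c : ℝ} (hc : 0 < c) (h : ∀ m, c ≤ σ (m + 1) - σ m) : ℝ ≃ₜ ℝ :=
  ((strictMono_interp hc h).orderIsoOfSurjective _ (surjective_interp hc h)).toHomeomorph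

@[simp]
lemma interpHomeo_apply (σ : ℤ → ℝ) {c : ℝ} (hc : 0 < c) (h : ∀ m, c ≤ σ (m + 1) - σ m) (r : ℝ) :
    interpHomeo σ hc h r = interp σ r := rfl

end

section

/-! ### Limits of continua along an ultrafilter. -/

section UltraLimit

variable {Z ι : Type*} [TopologicalSpace Z] {F : Ultrafilter ι} {C : ι → Set Z}

/-- The limit of a family of sets along an ultrafilter. -/
def ultraLimit (F : Ultrafilter ι) (C : ι → Set Z) : Set Z :=
  {z | ∀ W ∈ 𝓝 z, ∀ᶠ n in (F : Filter ι), (W ∩ C n).Nonempty}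

lemma mem_ultraLimit_of_tendsto {a : ι → Z} {z : Z} (ha : ∀ᶠ n in (F : Filter ι), a n ∈ C n)
    (h : Tendsto a F (𝓝 z)) : z ∈ ultraLimit F C := by
  intro W hW
  filter_upwards [h.eventually hW, ha] with n h1 h2
  exact ⟨a n, h1, h2⟩

lemma prodMk_mem_of_mem_ultraLimit {R : Set (Z × Z)} (hR : IsClosed R)
    (h : ∀ᶠ n in (F : Filter ι), ∀ c ∈ C n, ∀ c' ∈ C n, (c, c') ∈ R) {z z' : Z}
    (hz : z ∈ ultraLimit F C) (hz' : z' ∈ ultraLimit F C) : (z, z') ∈ R := by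
  by_contra hcon
  obtain ⟨W, hW, W', hW', hsub⟩ := mem_nhds_prod_iff.1 (hR.isOpen_compl.mem_nhds hcon)
  obtain ⟨n, ⟨c, hcW, hc⟩, ⟨c', hcW', hc'⟩, hn⟩ := ((hz W hW).and ((hz' W' hW').and h)).exists
  exact hsub (mk_mem_prod hcW hcW') (hn c hc c' hc')

lemma mem_of_mem_ultraLimit {Q : Set Z} (hQ : IsClosed Q)
    (h : ∀ᶠ n in (F : Filter ι), C n ⊆ Q) {z : Z} (hz : z ∈ ultraLimit F C) : z ∈ Q :=
  prodMk_mem_of_mem_ultraLimit (R := Prod.fst ⁻¹' Q) (hQ.preimage continuous_fst)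
    (h.mono fun _ hn _ hc _ _ => hn hc) hz hz

lemma isClosed_ultraLimit : IsClosed (ultraLimit F C) := by
  rw [← isOpen_compl_iff, isOpen_iff_mem_nhds]
  intro z hz
  simp only [ultraLimit, mem_compl_iff, mem_ofPred_eq, not_forall] at hz
  obtain ⟨W, hW, hWn⟩ := hz
  obtain ⟨O, hOW, hO, hzO⟩ := mem_nhds_iff.1 hW
  filter_upwards [hO.mem_nhds hzO] with w hw hwl
  exact hWn ((hwl O (hO.mem_nhds hw)).mono fun n hn => hn.mono (inter_subset_inter_left _ hOW))

/-- If the limit lies in disjoint open sets `O` and `O'`, compactness puts almost every `C n` in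
their union, and connectedness puts it in one of them. The ultrafilter decides which, and the limit
has no point in the other. -/
lemma isConnected_ultraLimit [T2Space Z] {Q : Set Z} (hQ : IsCompact Q) (hC : ∀ n, C n ⊆ Q)
    (hconn : ∀ n, IsConnected (C n)) : IsConnected (ultraLimit F C) := by
  have hlim : ∀ a : ι → Z, (∀ n, a n ∈ C n) → ∃ z ∈ ultraLimit F C, Tendsto a F (𝓝 z) := by
    intro a ha
    obtain ⟨z, -, hz⟩ := hQ.ultrafilter_le_nhds (F.map a)
      (le_principal_iff.2 (mem_map.2 (univ_mem' fun n => hC n (ha n))))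
    exact ⟨z, mem_ultraLimit_of_tendsto (Eventually.of_forall ha) hz, hz⟩
  choose a₀ ha₀ using fun n => (hconn n).nonempty
  obtain ⟨z₀, hz₀, -⟩ := hlim a₀ ha₀
  refine ⟨⟨z₀, hz₀⟩, ?_⟩
  have hsub : ultraLimit F C ⊆ Q := fun z hz =>
    mem_of_mem_ultraLimit hQ.isClosed (Eventually.of_forall hC) hz
  have hcpt : IsCompact (ultraLimit F C) := hQ.of_isClosed_subset isClosed_ultraLimit hsub
  rw [isPreconnected_iff_subset_of_fully_disjoint_closed isClosed_ultraLimit]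
  intro u v hu hv huv hdisj
  obtain ⟨O, O', hO, hO', hKO, hKO', hOO'⟩ := SeparatedNhds.of_isCompact_isCompact
    (hcpt.inter_right hu) (hcpt.inter_right hv)
    (hdisj.mono inter_subset_right inter_subset_right)
  have hev : ∀ᶠ n in (F : Filter ι), C n ⊆ O ∪ O' := by
    by_contra hcon
    rw [← Ultrafilter.frequently_iff_eventually, not_frequently] at hcon
    have hex : ∀ n, ∃ a ∈ C n, ¬ C n ⊆ O ∪ O' → a ∉ O ∪ O' := by
      intro n
      by_cases hn : C n ⊆ O ∪ O'
      · exact ⟨a₀ n, ha₀ n, fun h => absurd hn h⟩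
      · obtain ⟨a, ha, hna⟩ := not_subset.1 hn
        exact ⟨a, ha, fun _ => hna⟩
    choose a ha hna using hex
    obtain ⟨z, hz, hza⟩ := hlim a ha
    have hzO : z ∈ O ∪ O' := (huv hz).imp (fun h => hKO ⟨hz, h⟩) fun h => hKO' ⟨hz, h⟩
    obtain ⟨n, h1, h2⟩ :=
      ((hza.eventually ((hO.union hO').mem_nhds hzO)).and hcon).exists
    exact hna n h2 h1
  have hev' : ∀ᶠ n in (F : Filter ι), C n ⊆ O ∨ C n ⊆ O' := hev.mono fun n hn =>
    (isPreconnected_iff_subset_of_disjoint.1 (hconn n).isPreconnected) O O' hO hO' hn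
      (by rw [hOO'.inter_eq, inter_empty])
  rcases Ultrafilter.eventually_or.1 hev' with h | h
  · left
    intro z hz
    refine (huv hz).resolve_right fun hzv => ?_
    obtain ⟨n, ⟨c, hcO, hc⟩, hn⟩ := ((hz O' (hO'.mem_nhds (hKO' ⟨hz, hzv⟩))).and h).exists
    exact hOO'.ne_of_mem (hn hc) hcO rfl
  · right
    intro z hz
    refine (huv hz).resolve_left fun hzu => ?_
    obtain ⟨n, ⟨c, hcO, hc⟩, hn⟩ := ((hz O (hO.mem_nhds (hKO ⟨hz, hzu⟩))).and h).exists
    exact hOO'.ne_of_mem hcO (hn hc) rfl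

end UltraLimit

/-! ### Cw-expansiveness forces synchronised continua to shrink. -/

variable {M : Type*} [MetricSpace M] {X : Flow ℝ M} {ε θ ρ : ℝ} {U V : Set M}

lemma flow_interp (X : Flow ℝ M) (σ : ℤ → ℝ) (r : ℝ) (z : M) :
    X (interp σ r) z = X (Int.fract r * (σ (⌊r⌋ + 1) - σ ⌊r⌋)) (X (σ ⌊r⌋) z) := by
  rw [interp, add_comm, X.map_add]

lemma abs_fract_mul_le {g C : ℝ} (r : ℝ) (hg : |g| ≤ C) : |Int.fract r * g| ≤ C := by
  rw [abs_mul, abs_of_nonneg (Int.fract_nonneg r)]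
  exact (mul_le_of_le_one_left (abs_nonneg g) (Int.fract_lt_one r).le).trans hg

/-- A continuum whose points are synchronised by sequences of times with gaps bounded below is
contained in a short orbit segment, if the corresponding points stay close for all times. -/
lemma subset_tube_of_dist_le {ε' δ' D : ℝ} (hδ' : ∀ A : Set M, IsCompact A → IsConnected A →
      ∀ (α : A → ℝ ≃ₜ ℝ) (p : A), IsReparam α p →
        (∀ t : ℝ, Metric.diam (reparamImage X α t) < δ') → A ⊆ tube X ε' {(p : M)})
    (hD0 : 0 ≤ D) (hD : D < δ') {K : Set M} (hK : IsCompact K) (hKc : IsConnected K)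
    (σ : K → ℤ → ℝ) (hcont : ∀ m, Continuous fun z => σ z m) (h0 : ∀ z, σ z 0 = 0) {c : ℝ}
    (hc : 0 < c) (hgap : ∀ z m, c ≤ σ z (m + 1) - σ z m)
    (hdist : ∀ (r : ℝ) (z z' : K),
      dist (X (interp (σ z) r) (z : M)) (X (interp (σ z') r) (z' : M)) ≤ D) (p : K) :
    K ⊆ tube X ε' {(p : M)} := by
  -- Composing with the inverse of the time change of `p` makes `p` the guide; clock time `t` then
  -- corresponds to one real index `r` common to all points.
  refine hδ' K hK hKc
    (fun z => (interpHomeo (σ p) hc (hgap p)).symm.trans (interpHomeo (σ z) hc (hgap z))) p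
    ⟨?_, ?_, ?_⟩ ?_
  · intro z
    have h : ∀ w, interpHomeo (σ w) hc (hgap w) 0 = 0 := fun w => by
      simpa [h0] using interp_intCast (σ w) 0
    have hp : (interpHomeo (σ p) hc (hgap p)).symm 0 = 0 := by
      rw [Homeomorph.symm_apply_eq, h]
    simp only [Homeomorph.trans_apply, hp, h]
  · ext t
    simp only [Homeomorph.trans_apply, Homeomorph.apply_symm_apply, Homeomorph.refl_apply, id]
  · intro t
    simp only [Homeomorph.trans_apply, interpHomeo_apply, interp]
    exact (hcont _).add (continuous_const.mul ((hcont _).sub (hcont _)))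
  · intro t
    refine (Metric.diam_le_of_forall_dist_le hD0 ?_).trans_lt hD
    rintro _ ⟨z, rfl⟩ _ ⟨z', rfl⟩
    exact hdist _ z z'

variable [CompactSpace M]

/-- Closeness is assumed only at indices `n ≥ 0`, but recentring at `n → ∞` makes it two-sided in
the limit, where cw-expansiveness applies. The constant `η` does not depend on `A` or `σ`. -/
lemma IsTransversal.tendsto_diam (hX : CWExpansive X) (h : IsTransversal X ε θ ρ U V) {c C : ℝ}
    (hc : 0 < c) :
    ∃ η > 0, ∀ (A : Set M) (σ : M → ℤ → ℝ), IsCompact A → IsConnected A →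
      (∀ m, ContinuousOn (fun a => σ a m) A) →
      (∀ a ∈ A, ∀ m, c ≤ σ a (m + 1) - σ a m ∧ σ a (m + 1) - σ a m ≤ C) →
      (∀ a ∈ A, ∀ a' ∈ A, ∀ m, |(σ a (m + 1) - σ a m) - (σ a' (m + 1) - σ a' m)| ≤ η) →
      (∀ a ∈ A, ∀ n : ℕ, X (σ a n) a ∈ U) →
      (∀ a ∈ A, ∀ a' ∈ A, ∀ n : ℕ, dist (X (σ a n) a) (X (σ a' n) a') ≤ η) →
      Tendsto (fun n : ℕ => Metric.diam ((fun a => X (σ a n) a) '' A)) atTop (𝓝 0) := by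
  obtain ⟨δ', hδ'0, hδ'⟩ := hX ρ h.pos
  obtain ⟨η₁, hη₁, huc⟩ := exists_dist_flow_lt X C (half_pos hδ'0)
  refine ⟨min (η₁ / 2) ρ, lt_min (half_pos hη₁) h.pos, ?_⟩
  intro A σ hA hAc hcont hgap hgap2 hU hpos
  have hC0 : 0 ≤ C := by
    obtain ⟨a, ha⟩ := hAc.nonempty
    linarith [(hgap a ha 0).1, (hgap a ha 0).2]
  by_contra hcon
  obtain ⟨c₀, hc₀, hfreq⟩ : ∃ c₀ > 0, ∃ᶠ n : ℕ in atTop,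
      c₀ ≤ Metric.diam ((fun a => X (σ a n) a) '' A) := by
    rw [Metric.tendsto_nhds] at hcon
    push Not at hcon
    obtain ⟨c₀, hc₀, hf⟩ := hcon
    refine ⟨c₀, hc₀, hf.mono fun n hn => ?_⟩
    rwa [Real.dist_eq, sub_zero, abs_of_nonneg Metric.diam_nonneg] at hn
  have hne : (atTop ⊓ 𝓟 {n : ℕ | c₀ ≤ Metric.diam ((fun a => X (σ a n) a) '' A)}).NeBot :=
    frequently_mem_iff_neBot.1 hfreq
  obtain ⟨F, hF⟩ := Ultrafilter.exists_le
    (atTop ⊓ 𝓟 {n : ℕ | c₀ ≤ Metric.diam ((fun a => X (σ a n) a) '' A)})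
  have hFtop : (F : Filter ℕ) ≤ atTop := hF.trans inf_le_left
  have hFdiam : ∀ᶠ n : ℕ in (F : Filter ℕ), c₀ ≤ Metric.diam ((fun a => X (σ a n) a) '' A) :=
    le_principal_iff.1 (hF.trans inf_le_right)
  set Φ : ℕ → M → M × (ℤ → ℝ) := fun n a => (X (σ a n) a, fun m => σ a (n + m) - σ a n) with hΦ
  set Q : Set (M × (ℤ → ℝ)) :=
    univ ×ˢ (univ.pi fun m : ℤ => Icc (-(C * |(m : ℝ)|)) (C * |(m : ℝ)|)) with hQ
  have hQc : IsCompact Q := isCompact_univ.prod (isCompact_univ_pi fun _ => isCompact_Icc)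
  have hbound : ∀ a ∈ A, ∀ i j : ℤ, |σ a j - σ a i| ≤ C * |((j - i : ℤ) : ℝ)| := by
    intro a ha
    have hle : ∀ i j : ℤ, i ≤ j → |σ a j - σ a i| ≤ C * ((j - i : ℤ) : ℝ) := by
      intro i j hij
      have := abs_interp_sub_le (σ := σ a) (σ' := fun _ => 0) (κ := C) (fun m => by
        rw [sub_self, sub_zero, abs_of_nonneg (hc.le.trans (hgap a ha m).1)]
        exact (hgap a ha m).2) (r := i) (r' := j) (by exact_mod_cast hij)
      simp only [interp_intCast, sub_zero] at this
      push_cast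
      exact this
    intro i j
    rcases le_total i j with hij | hij
    · rw [abs_of_nonneg (a := ((j - i : ℤ) : ℝ)) (by exact_mod_cast sub_nonneg.2 hij)]
      exact hle i j hij
    · rw [abs_sub_comm, show ((j - i : ℤ) : ℝ) = -((i - j : ℤ) : ℝ) by push_cast; ring, abs_neg,
        abs_of_nonneg (a := ((i - j : ℤ) : ℝ)) (by exact_mod_cast sub_nonneg.2 hij)]
      exact hle j i hij
  have hΦQ : ∀ n, Φ n '' A ⊆ Q := by
    rintro n _ ⟨a, ha, rfl⟩
    refine ⟨mem_univ _, fun m _ => abs_le.1 ?_⟩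
    have := hbound a ha n (n + m)
    rwa [add_sub_cancel_left] at this
  have hΦcont : ∀ n, ContinuousOn (Φ n) A := by
    intro n
    refine ContinuousOn.prodMk (X.cont'.comp_continuousOn ((hcont n).prodMk continuousOn_id)) ?_
    exact continuousOn_pi.2 fun m => (hcont _).sub (hcont _)
  set L := ultraLimit F fun n => Φ n '' A with hL
  have hLc : IsCompact L := hQc.of_isClosed_subset isClosed_ultraLimit fun z hz =>
    mem_of_mem_ultraLimit hQc.isClosed (Eventually.of_forall hΦQ) hz
  have hLconn : IsConnected L :=
    isConnected_ultraLimit hQc hΦQ fun n => hAc.image _ (hΦcont n)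
  have hL0 : ∀ z ∈ L, z.2 0 = 0 := by
    intro z hz
    refine mem_of_mem_ultraLimit (Q := {z : M × (ℤ → ℝ) | z.2 0 = 0})
      (isClosed_eq (by fun_prop) continuous_const) (Eventually.of_forall ?_) hz
    rintro n _ ⟨a, -, rfl⟩
    simp [Φ]
  have hLgap : ∀ z ∈ L, ∀ m, c ≤ z.2 (m + 1) - z.2 m ∧ z.2 (m + 1) - z.2 m ≤ C := by
    intro z hz m
    refine mem_of_mem_ultraLimit
      (Q := {z : M × (ℤ → ℝ) | c ≤ z.2 (m + 1) - z.2 m ∧ z.2 (m + 1) - z.2 m ≤ C})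
      ((isClosed_le (g := fun z : M × (ℤ → ℝ) => z.2 (m + 1) - z.2 m) continuous_const
        (by fun_prop)).inter (isClosed_le (f := fun z : M × (ℤ → ℝ) => z.2 (m + 1) - z.2 m)
          (by fun_prop) continuous_const)) (Eventually.of_forall ?_) hz
    rintro n _ ⟨a, ha, rfl⟩
    have := hgap a ha (n + m)
    simp only [hΦ, mem_ofPred_eq, ← add_assoc]
    constructor <;> linarith
  -- For fixed `m`, the index `n + m` is eventually nonnegative, so the one-sided hypotheses pass to
  -- every `m` in the limit.
  have hshift : ∀ (m : ℤ), ∀ᶠ n : ℕ in (F : Filter ℕ), ∃ j : ℕ, (n : ℤ) + m = j := by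
    intro m
    filter_upwards [hFtop (eventually_ge_atTop m.natAbs)] with n hn
    have : (0 : ℤ) ≤ n + m := by
      have h1 : m.natAbs ≤ n := hn
      omega
    exact ⟨_, (Int.toNat_of_nonneg this).symm⟩
  have hΦflow : ∀ n a m, X ((Φ n a).2 m) (Φ n a).1 = X (σ a (n + m)) a := by
    intro n a m
    simp only [hΦ]
    rw [← X.map_add, sub_add_cancel]
  have hcflow : ∀ m : ℤ, Continuous fun z : M × (ℤ → ℝ) => X (z.2 m) z.1 := by
    intro m
    fun_prop
  have hLU : ∀ z ∈ L, ∀ m, X (z.2 m) z.1 ∈ U := by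
    intro z hz m
    refine mem_of_mem_ultraLimit (Q := {z : M × (ℤ → ℝ) | X (z.2 m) z.1 ∈ U})
      (h.isClosed.preimage (hcflow m)) ((hshift m).mono ?_) hz
    rintro n ⟨j, hj⟩ _ ⟨a, ha, rfl⟩
    rw [mem_ofPred_eq, hΦflow, hj]
    exact hU a ha j
  have hLdist : ∀ z ∈ L, ∀ z' ∈ L, ∀ m,
      dist (X (z.2 m) z.1) (X (z'.2 m) z'.1) ≤ min (η₁ / 2) ρ := by
    intro z hz z' hz' m
    refine prodMk_mem_of_mem_ultraLimit (R := {w : (M × (ℤ → ℝ)) × (M × (ℤ → ℝ)) |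
        dist (X (w.1.2 m) w.1.1) (X (w.2.2 m) w.2.1) ≤ min (η₁ / 2) ρ})
      (isClosed_le (((hcflow m).comp continuous_fst).dist ((hcflow m).comp continuous_snd))
        continuous_const) ((hshift m).mono ?_) hz hz'
    rintro n ⟨j, hj⟩ _ ⟨a, ha, rfl⟩ _ ⟨a', ha', rfl⟩
    rw [mem_ofPred_eq]
    dsimp only
    rw [hΦflow, hΦflow, hj]
    exact hpos a ha a' ha' j
  have hLgap2 : ∀ z ∈ L, ∀ z' ∈ L, ∀ m,
      |(z.2 (m + 1) - z.2 m) - (z'.2 (m + 1) - z'.2 m)| ≤ min (η₁ / 2) ρ := by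
    intro z hz z' hz' m
    refine prodMk_mem_of_mem_ultraLimit (R := {w : (M × (ℤ → ℝ)) × (M × (ℤ → ℝ)) |
        |(w.1.2 (m + 1) - w.1.2 m) - (w.2.2 (m + 1) - w.2.2 m)| ≤ min (η₁ / 2) ρ})
      (isClosed_le (f := fun w : (M × (ℤ → ℝ)) × (M × (ℤ → ℝ)) =>
        |(w.1.2 (m + 1) - w.1.2 m) - (w.2.2 (m + 1) - w.2.2 m)|) (by fun_prop)
        continuous_const) (Eventually.of_forall ?_) hz hz'
    rintro n _ ⟨a, ha, rfl⟩ _ ⟨a', ha', rfl⟩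
    have := hgap2 a ha a' ha' (n + m)
    simp only [hΦ, mem_ofPred_eq, ← add_assoc]
    convert this using 2
    ring
  -- Two sequences over the same point agree at `0`. If they agree at one index, at the next they
  -- give visits of one orbit to `U` at most `ρ < θ` apart, hence equal times; induct in both
  -- directions.
  have hinj : InjOn Prod.fst L := by
    intro z hz z' hz' heq
    refine Prod.ext heq (funext fun m => ?_)
    have hstep : ∀ i j : ℤ, |(z.2 i - z.2 j) - (z'.2 i - z'.2 j)| ≤ ρ → z.2 j = z'.2 j →
        z.2 i = z'.2 i := by
      intro i j hij hj
      refine h.eq_of_mem (hLU z hz i) (by rw [heq]; exact hLU z' hz' i) ?_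
      rw [hj, sub_sub_sub_cancel_right] at hij
      linarith [h.lt_theta, h.pos]
    induction m using Int.induction_on with
    | zero => rw [hL0 z hz, hL0 z' hz']
    | succ m ih => exact hstep _ _ ((hLgap2 z hz z' hz' m).trans (min_le_right _ _)) ih
    | pred m ih =>
      have h1 := (hLgap2 z hz z' hz' (-m - 1)).trans (min_le_right _ _)
      rw [sub_add_cancel] at h1
      refine hstep _ _ ?_ ih
      rw [abs_le] at h1 ⊢
      constructor <;> linarith
  set K : Set M := Prod.fst '' L with hK
  have : CompactSpace L := isCompact_iff_compactSpace.1 hLc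
  set e : L ≃ K := Equiv.Set.imageOfInjOn Prod.fst L hinj with he
  have hecont : Continuous e :=
    Continuous.subtype_mk (continuous_fst.comp continuous_subtype_val) _
  -- The inverse is continuous by compactness, so the times depend continuously on the point of `K`.
  set g := hecont.homeoOfEquivCompactToT2 with hg
  have hgL : ∀ z : K, ((g.symm z : L) : M × (ℤ → ℝ)).1 = z := fun z =>
    congrArg Subtype.val (g.apply_symm_apply z)
  have hsub : ∀ p : K, K ⊆ tube X ρ {(p : M)} := by
    refine subset_tube_of_dist_le hδ' (half_pos hδ'0).le (half_lt_self hδ'0)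
      (hLc.image continuous_fst) (hLconn.image _ continuous_fst.continuousOn)
      (fun z => ((g.symm z : L) : M × (ℤ → ℝ)).2)
      (fun m => (continuous_apply m).comp
        (continuous_snd.comp (continuous_subtype_val.comp g.symm.continuous)))
      (fun z => hL0 _ (g.symm z).2) hc (fun z m => (hLgap _ (g.symm z).2 m).1) ?_
    intro r z z'
    rw [flow_interp, flow_interp]
    have habs : ∀ w : K, |((g.symm w : L) : M × (ℤ → ℝ)).2 (⌊r⌋ + 1) -
        ((g.symm w : L) : M × (ℤ → ℝ)).2 ⌊r⌋| ≤ C := by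
      intro w
      obtain ⟨h1, h2⟩ := hLgap _ (g.symm w).2 ⌊r⌋
      rwa [abs_of_nonneg (hc.le.trans h1)]
    have hlt : min (η₁ / 2) ρ < η₁ := (min_le_left _ _).trans_lt (half_lt_self hη₁)
    refine (huc _ _ _ _ (abs_fract_mul_le r (habs z)) (abs_fract_mul_le r (habs z')) ?_ ?_).le
    · have := hLdist _ (g.symm z).2 _ (g.symm z').2 ⌊r⌋
      rw [hgL, hgL] at this
      exact this.trans_lt hlt
    · rw [← mul_sub]
      exact (abs_fract_mul_le r (hLgap2 _ (g.symm z).2 _ (g.symm z').2 ⌊r⌋)).trans_lt hlt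
  -- Pairs realising half of the diameter, whose limits will be two distinct points of `K`.
  have hfar : ∀ n : ℕ, ∃ a ∈ A, ∃ b ∈ A, c₀ ≤ Metric.diam ((fun a => X (σ a n) a) '' A) →
      c₀ / 2 ≤ dist (X (σ a n) a) (X (σ b n) b) := by
    intro n
    by_contra! hall
    obtain ⟨a, ha⟩ := hAc.nonempty
    have hle : Metric.diam ((fun a => X (σ a n) a) '' A) ≤ c₀ / 2 := by
      refine Metric.diam_le_of_forall_dist_le (half_pos hc₀).le ?_
      rintro _ ⟨a, ha, rfl⟩ _ ⟨b, hb, rfl⟩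
      exact (hall a ha b hb).2.le
    linarith [(hall a ha a ha).1]
  choose a ha b hb hab using hfar
  have hlim : ∀ a : ℕ → M, (∀ n, a n ∈ A) →
      ∃ z ∈ L, Tendsto (fun n => Φ n (a n)) F (𝓝 z) := by
    intro a ha
    have hmem : ∀ n, Φ n (a n) ∈ Φ n '' A := fun n => ⟨a n, ha n, rfl⟩
    obtain ⟨z, -, hz⟩ := hQc.ultrafilter_le_nhds (F.map fun n => Φ n (a n))
      (le_principal_iff.2 (mem_map.2 (univ_mem' fun n => hΦQ n (hmem n))))
    exact ⟨z, mem_ultraLimit_of_tendsto (Eventually.of_forall hmem) hz, hz⟩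
  obtain ⟨z, hz, hza⟩ := hlim a ha
  obtain ⟨w, hw, hwb⟩ := hlim b hb
  have hzw : c₀ / 2 ≤ dist z.1 w.1 := by
    refine ge_of_tendsto (((continuous_fst.tendsto z).comp hza).dist
      ((continuous_fst.tendsto w).comp hwb)) (hFdiam.mono fun n hn => hab n hn)
  obtain ⟨t, ht, _, rfl, htw⟩ := hsub ⟨z.1, z, hz, rfl⟩ ⟨w, hw, rfl⟩
  have hUz : ∀ v ∈ L, v.1 ∈ U := by
    intro v hv
    have := hLU v hv 0
    rwa [hL0 v hv, X.map_zero_apply] at this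
  dsimp only at htw
  have ht0 := h.eq_zero _ (hUz z hz) t
    ((abs_lt.2 ht).trans (by linarith [h.pos, h.lt_theta])) (by rw [htw]; exact hUz w hw)
  rw [ht0, X.map_zero_apply] at htw
  rw [htw, dist_self] at hzw
  linarith

end

/-! ### Synchronisation of small iterates and change of guide. -/

section

variable {M : Type*} [MetricSpace M] {X : Flow ℝ M} {ε θ ρ ε₀ : ℝ} {U V : Set M}

/-- The extension of `trackTime` to negative indices by an arithmetic progression of step `ε`. -/
def extTime (X : Flow ℝ M) (ε ρ : ℝ) (U V : Set M) (x a : M) : ℤ → ℝ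
  | Int.ofNat n => trackTime X ρ U V x n a
  | Int.negSucc n => -(ε * (n + 1))

lemma extTime_negSucc_gap (x a : M) (n : ℕ) :
    extTime X ε ρ U V x a (Int.negSucc n + 1) - extTime X ε ρ U V x a (Int.negSucc n) = ε := by
  cases n with
  | zero => simp [extTime, trackTime]
  | succ n =>
    rw [show Int.negSucc (n + 1) + 1 = Int.negSucc n from rfl]
    simp only [extTime]
    push_cast
    ring

/-- A family of sequences of times synchronising the points of `A`: the gaps are bounded and nearly
independent of the point, and for nonnegative indices the points reached lie in `U`, close to each
other. -/
structure IsSynchronised (X : Flow ℝ M) (U : Set M) (c C κ : ℝ) (A : Set M)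
    (σ : M → ℤ → ℝ) : Prop where
  zero : ∀ a ∈ A, σ a 0 = 0
  continuousOn : ∀ m, ContinuousOn (fun a => σ a m) A
  gap : ∀ a ∈ A, ∀ m, c ≤ σ a (m + 1) - σ a m ∧ σ a (m + 1) - σ a m ≤ C
  gap_close : ∀ a ∈ A, ∀ a' ∈ A, ∀ m, |(σ a (m + 1) - σ a m) - (σ a' (m + 1) - σ a' m)| ≤ κ
  mem : ∀ a ∈ A, ∀ n : ℕ, X (σ a n) a ∈ U
  close : ∀ a ∈ A, ∀ a' ∈ A, ∀ n : ℕ, dist (X (σ a n) a) (X (σ a' n) a') ≤ κ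

variable [CompactSpace M]

lemma exists_dist_interp_lt (X : Flow ℝ M) (U : Set M) {c C D : ℝ} (hc : 0 < c) (hD : 0 < D) :
    ∃ κ > 0, ∀ (κ' : ℝ) (A : Set M) (σ : M → ℤ → ℝ), κ' ≤ κ → IsSynchronised X U c C κ' A σ →
      ∀ a ∈ A, ∀ a' ∈ A, ∀ r : ℝ, 0 ≤ r →
        dist (X (interp (σ a) r) a) (X (interp (σ a') r) a') < D := by
  obtain ⟨η, hη, huc⟩ := exists_dist_flow_lt X C hD
  refine ⟨η / 2, half_pos hη, fun κ' A σ hκ' h a ha a' ha' r hr => ?_⟩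
  have hlt : κ' < η := by linarith
  have habs : ∀ b ∈ A, |σ b (⌊r⌋ + 1) - σ b ⌊r⌋| ≤ C := by
    intro b hb
    obtain ⟨h1, h2⟩ := h.gap b hb ⌊r⌋
    rwa [abs_of_nonneg (hc.le.trans h1)]
  rw [flow_interp, flow_interp]
  refine huc _ _ _ _ (abs_fract_mul_le r (habs a ha)) (abs_fract_mul_le r (habs a' ha')) ?_ ?_
  · rw [← Int.toNat_of_nonneg (Int.floor_nonneg.2 hr)]
    exact (h.close a ha a' ha' _).trans_lt hlt
  · rw [← mul_sub]
    exact (abs_fract_mul_le r (h.gap_close a ha a' ha' _)).trans_lt hlt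

section Core

variable {k : ℕ} {S T : Fin k → Set M}

/-- After the guide's return time a point of a small iterate lies near `V ⊆ U`, so
`exists_small_return` improves the bound `ρ` on its projection time to `κ / 2`. The artificial gaps
`ε` at negative indices lie between `ρ` and `ε + ρ`, as `2ρ < θ ≤ ε`. -/
lemma IsTransversal.exists_isSynchronised (h : IsTransversal X ε θ ρ (⋃ i, S i) (⋃ i, T i))
    (hε₀ : 0 < ε₀)
    (hs : ∀ i j, ∀ x ∈ S i, ∀ y ∈ S i, dist x y < ε₀ → ∀ t : ℝ, |t| ≤ ε →
      X t x ∈ T j → X t y ∈ tube X ρ (S j)) {κ : ℝ} (hκ : 0 < κ) :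
    ∃ η > 0, η ≤ ε₀ ∧ ∀ (A : Set M) (x : M), x ∈ A → (∃ j, A ⊆ S j) →
      (∀ n : ℕ, Metric.diam (fwdIter X S T ρ A x n) < η) →
      IsSynchronised X (⋃ i, S i) ρ (ε + ρ) κ A
        (extTime X ε ρ (⋃ i, S i) (⋃ i, T i) x) ∧
      ∀ n : ℕ, fwdIter X S T ρ A x n =
        (fun a => X (extTime X ε ρ (⋃ i, S i) (⋃ i, T i) x a n) a) '' A := by
  obtain ⟨η₁, hη₁, hsl⟩ := h.exists_small_return (half_pos hκ)
  obtain ⟨η₂, hη₂, huc⟩ := exists_dist_flow_lt X ε hη₁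
  refine ⟨min ε₀ (min η₂ κ), lt_min hε₀ (lt_min hη₂ hκ), min_le_left _ _, ?_⟩
  intro A x hxA hAS hd
  have hxU : x ∈ ⋃ i, S i := by
    obtain ⟨j, hj⟩ := hAS
    exact mem_iUnion.2 ⟨j, hj hxA⟩
  have hF := fun n => h.fwdIter_eq hs hxA hAS n fun m _ => (hd m).trans_le (min_le_left _ _)
  set U := ⋃ i, S i with hU
  set V := ⋃ i, T i with hV
  set β := trackTime X ρ U V x with hβ
  have hmem : ∀ n, ∀ a ∈ A, X (β n a) a ∈ fwdIter X S T ρ A x n := by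
    intro n a ha
    rw [(hF n).1]
    exact ⟨a, ha, rfl⟩
  have hdist : ∀ n, ∀ a ∈ A, ∀ a' ∈ A,
      dist (X (β n a) a) (X (β n a') a') < min ε₀ (min η₂ κ) := fun n a ha a' ha' =>
    (Metric.dist_le_diam_of_mem Metric.isBounded_of_compactSpace (hmem n a ha)
      (hmem n a' ha')).trans_lt (hd n)
  have hβU : ∀ n, ∀ a ∈ A, X (β n a) a ∈ U := by
    intro n a ha
    obtain ⟨j, hj⟩ := (hF n).2.1
    exact mem_iUnion.2 ⟨j, hj (hmem n a ha)⟩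
  have hτ := fun n => h.returnTime_spec (h.iterate_mem hxU n)
  have hgap := fun n => (hF (n + 1)).2.2.2 n n.lt_succ_self
  have hgap2 : ∀ n, ∀ a ∈ A,
      |β (n + 1) a - β n a - returnTime X V ((firstReturn X V)^[n] x)| < κ / 2 := by
    intro n a ha
    set τ := returnTime X V ((firstReturn X V)^[n] x)
    have hτabs : |τ| ≤ ε := by
      rw [abs_of_nonneg (h.theta_pos.le.trans (hτ n).1.1)]
      exact (hτ n).1.2
    refine hsl (X τ ((firstReturn X V)^[n] x)) (h.subset (hτ n).2) (X τ (X (β n a) a)) _ ?_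
      (by linarith [hgap n a ha, h.pos]) ?_
    · refine huc _ _ _ _ hτabs hτabs ?_ (by simpa using hη₂)
      rw [← (h.trackTime_self hxU n).1]
      exact (hdist n x hxA a ha).trans_le ((min_le_right _ _).trans (min_le_left _ _))
    · rw [← X.map_add, ← X.map_add, sub_add_cancel, sub_add_cancel]
      exact hβU _ a ha
  have hle : θ ≤ ε := (hτ 0).1.1.trans (hτ 0).1.2
  have hpos := h.pos
  have hlt := h.lt_theta
  refine ⟨⟨fun a _ => rfl, ?_, ?_, ?_, ?_, ?_⟩, fun n => (hF n).1⟩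
  · rintro (n | n)
    · exact (hF n).2.2.1
    · exact continuousOn_const
  · rintro a ha (n | n)
    · have h1 := abs_lt.1 (hgap n a ha)
      have h2 := (hτ n).1
      change ρ ≤ β (n + 1) a - β n a ∧ β (n + 1) a - β n a ≤ ε + ρ
      constructor <;> linarith [h2.1, h2.2]
    · rw [extTime_negSucc_gap]
      constructor <;> linarith
  · rintro a ha a' ha' (n | n)
    · have h1 := abs_lt.1 (hgap2 n a ha)
      have h2 := abs_lt.1 (hgap2 n a' ha')
      change |(β (n + 1) a - β n a) - (β (n + 1) a' - β n a')| ≤ κ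
      rw [abs_le]
      constructor <;> linarith
    · rw [extTime_negSucc_gap, extTime_negSucc_gap, sub_self, abs_zero]
      exact hκ.le
  · exact fun a ha n => hβU n a ha
  · exact fun a ha a' ha' n =>
      ((hdist n a ha a' ha').trans_le ((min_le_right _ _).trans (min_le_right _ _))).le

/-- Changing the guide keeps the iterates small. -/
lemma IsTransversal.exists_diam_fwdIter_lt (h : IsTransversal X ε θ ρ (⋃ i, S i) (⋃ i, T i))
    (hε : 0 < ε)
    (hs : ∀ i j, ∀ x ∈ S i, ∀ y ∈ S i, dist x y < ε₀ → ∀ t : ℝ, |t| ≤ ε →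
      X t x ∈ T j → X t y ∈ tube X ρ (S j)) {η₁ : ℝ} (hη₁ : 0 < η₁) (hη₁ε₀ : η₁ ≤ ε₀) :
    ∃ η > 0, η ≤ ε₀ ∧ ∀ (A : Set M) (x : M), x ∈ A → (∃ j, A ⊆ S j) →
      (∀ n : ℕ, Metric.diam (fwdIter X S T ρ A x n) < η) →
      ∀ y ∈ A, ∀ n : ℕ, Metric.diam (fwdIter X S T ρ A y n) < η₁ := by
  have hρ := h.pos
  obtain ⟨ξ, hξ, huc⟩ := exists_dist_flow_lt X ρ (half_pos hη₁)
  set κ₁ := min (ρ / 2) (ξ / 2) with hκ₁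
  have hκ₁0 : 0 < κ₁ := lt_min (half_pos hρ) (half_pos hξ)
  obtain ⟨η₂, hη₂, hsl⟩ := h.exists_small_return hκ₁0
  obtain ⟨κ, hκ, hint⟩ := exists_dist_interp_lt X (⋃ i, S i) (c := ρ) (C := ε + ρ) hρ
    (lt_min hη₂ hξ)
  -- One return of `y` takes time at most `ε`, hence spans at most `ε / ρ` indices; this bound on
  -- `κ'` keeps the drift during it at most `ρ / 2`.
  set κ' := min κ (ρ * ρ / (2 * ε)) with hκ'
  have hκ'0 : 0 < κ' := lt_min hκ (by positivity)
  obtain ⟨η, hη, hηε₀, hsync⟩ := h.exists_isSynchronised (hη₁.trans_le hη₁ε₀) hs hκ'0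
  refine ⟨η, hη, hηε₀, fun A x hxA hAS hd y hyA => ?_⟩
  obtain ⟨hσ, -⟩ := hsync A x hxA hAS hd
  have hyU : y ∈ ⋃ i, S i := by
    obtain ⟨j, hj⟩ := hAS
    exact mem_iUnion.2 ⟨j, hj hyA⟩
  set U := ⋃ i, S i with hU
  set V := ⋃ i, T i with hV
  set σ := extTime X ε ρ U V x
  set β := trackTime X ρ U V y with hβ
  have hD := hint κ' A σ (min_le_left _ _) hσ
  have hgapy : ∀ m, ρ ≤ σ y (m + 1) - σ y m := fun m => (hσ.gap y hyA m).1
  have hsmall : ∀ n, (∀ m < n, Metric.diam (fwdIter X S T ρ A y m) < η₁) →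
      (∃ r : ℝ, 0 ≤ r ∧ ∀ a ∈ A, |β n a - interp (σ a) r| < κ₁) →
      Metric.diam (fwdIter X S T ρ A y n) < η₁ := by
    rintro n hn ⟨r, hr, hrA⟩
    rw [(h.fwdIter_eq hs hyA hAS n fun m hm => (hn m hm).trans_le hη₁ε₀).1]
    refine (Metric.diam_le_of_forall_dist_le (half_pos hη₁).le ?_).trans_lt (half_lt_self hη₁)
    rintro _ ⟨a, ha, rfl⟩ _ ⟨b, hb, rfl⟩
    dsimp only
    have heq : ∀ c, X (β n c) c = X (β n c - interp (σ c) r) (X (interp (σ c) r) c) := by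
      intro c
      rw [← X.map_add, sub_add_cancel]
    have h1 : κ₁ ≤ ρ / 2 := min_le_left _ _
    have h2 : κ₁ ≤ ξ / 2 := min_le_right _ _
    have ha' := hrA a ha
    have hb' := hrA b hb
    rw [← hβ, heq a, heq b]
    refine (huc _ _ _ _ (by linarith) (by linarith)
      ((hD a ha b hb r hr).trans_le (min_le_right _ _)) ?_).le
    have := abs_sub (β n a - interp (σ a) r) (β n b - interp (σ b) r)
    linarith
  -- The index `r` is real because the returns of `y` need not match the integer indices of `x`. The
  -- same error bound `κ₁` is recovered at each step.
  have hmain : ∀ n, (∀ m < n, Metric.diam (fwdIter X S T ρ A y m) < η₁) ∧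
      ∃ r : ℝ, 0 ≤ r ∧ interp (σ y) r = β n y ∧ ∀ a ∈ A, |β n a - interp (σ a) r| < κ₁ := by
    intro n
    induction n with
    | zero =>
      have h0 : ∀ a ∈ A, interp (σ a) 0 = β 0 a := by
        intro a ha
        have := interp_intCast (σ a) 0
        rw [Int.cast_zero, hσ.zero a ha] at this
        exact this
      refine ⟨by simp, 0, le_rfl, h0 y hyA, fun a ha => ?_⟩
      rw [h0 a ha, sub_self, abs_zero]
      exact hκ₁0
    | succ n ih =>
      obtain ⟨hlt, r, hr, hry, hrA⟩ := ih
      have hn : Metric.diam (fwdIter X S T ρ A y n) < η₁ := hsmall n hlt ⟨r, hr, hrA⟩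
      have hlt' : ∀ m < n + 1, Metric.diam (fwdIter X S T ρ A y m) < η₁ := by
        intro m hm
        rcases Nat.lt_succ_iff_lt_or_eq.1 hm with hm | rfl
        · exact hlt m hm
        · exact hn
      obtain ⟨him, ⟨j, hj⟩, -, hgap⟩ :=
        h.fwdIter_eq hs hyA hAS (n + 1) fun m hm => (hlt' m hm).trans_le hη₁ε₀
      have hβU : ∀ a ∈ A, X (β (n + 1) a) a ∈ U := by
        intro a ha
        refine mem_iUnion.2 ⟨j, hj ?_⟩
        rw [him]
        exact ⟨a, ha, rfl⟩
      have hτ := (h.returnTime_spec (h.iterate_mem hyU n)).1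
      have hself := (h.trackTime_self hyU n).2
      set τ := returnTime X V ((firstReturn X V)^[n] y) with hτdef
      obtain ⟨r', hr'⟩ := surjective_interp hρ hgapy (β (n + 1) y)
      have hself' : β (n + 1) y = β n y + τ := hself
      have hrr' : r ≤ r' := by
        rw [← (strictMono_interp hρ hgapy).le_iff_le, hry, hr', hself']
        linarith [hτ.1, h.theta_pos]
      refine ⟨hlt', r', hr.trans hrr', hr', fun a ha => ?_⟩
      have hlen : ρ * (r' - r) ≤ ε := by
        have := mul_sub_le_interp_sub hgapy hrr'
        rw [hry, hr', hself'] at this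
        linarith [hτ.2]
      have hslope : κ' * (r' - r) ≤ ρ / 2 := by
        have h1 : κ' * (2 * ε) ≤ ρ * ρ := by
          have : κ' ≤ ρ * ρ / (2 * ε) := min_le_right _ _
          rwa [le_div_iff₀ (by positivity)] at this
        have h2 : κ' * (ρ * (r' - r)) ≤ κ' * ε := mul_le_mul_of_nonneg_left hlen hκ'0.le
        have h3 : ρ * (κ' * (r' - r)) ≤ ρ * (ρ / 2) := by linarith
        exact le_of_mul_le_mul_left h3 hρ
      have hdiff := abs_le.1
        ((abs_interp_sub_le (hσ.gap_close a ha y hyA) hrr').trans hslope)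
      rw [hry, hr', hself'] at hdiff
      have hg := abs_lt.1 (hgap n n.lt_succ_self a ha)
      have hra := abs_lt.1 (hrA a ha)
      have hκ₁ρ : κ₁ ≤ ρ / 2 := min_le_left _ _
      rw [← hβ] at hg
      -- Old error `ρ / 2`, drift `ρ / 2` and projection time `ρ` total less than `2ρ`; since both
      -- endpoints are in `U`, `exists_small_return` brings the new error back below `κ₁`.
      refine hsl (X (β (n + 1) y) y) (hβU y hyA) (X (interp (σ a) r') a) _ ?_ ?_ ?_
      · rw [← hr']
        exact (hD y hyA a ha r' (hr.trans hrr')).trans_le (min_le_left _ _)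
      · rw [abs_le]
        constructor <;> linarith [hg.1, hg.2, hra.1, hra.2, hdiff.1, hdiff.2]
      · rw [← X.map_add, sub_add_cancel]
        exact hβU a ha
  intro n
  exact (hmain (n + 1)).1 n n.lt_succ_self

lemma IsTransversal.exists_tendsto_diam_fwdIter (hX : CWExpansive X)
    (h : IsTransversal X ε θ ρ (⋃ i, S i) (⋃ i, T i)) (hε : 0 < ε) (hε₀ : 0 < ε₀)
    (hs : ∀ i j, ∀ x ∈ S i, ∀ y ∈ S i, dist x y < ε₀ → ∀ t : ℝ, |t| ≤ ε →
      X t x ∈ T j → X t y ∈ tube X ρ (S j)) :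
    ∃ η > 0, η ≤ ε₀ ∧ ∀ (A : Set M) (x : M), IsCompact A → IsConnected A → x ∈ A →
      (∃ j, A ⊆ S j) → (∀ n : ℕ, Metric.diam (fwdIter X S T ρ A x n) < η) →
      ∀ y ∈ A, (∀ n : ℕ, Metric.diam (fwdIter X S T ρ A y n) < ε₀) ∧
        Tendsto (fun n : ℕ => Metric.diam (fwdIter X S T ρ A y n)) atTop (𝓝 0) := by
  obtain ⟨κ, hκ, hlim⟩ := h.tendsto_diam hX h.pos (C := ε + ρ)
  obtain ⟨η₁, hη₁, hη₁ε₀, hsync⟩ := h.exists_isSynchronised hε₀ hs hκ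
  obtain ⟨η, hη, hηε₀, hguide⟩ := h.exists_diam_fwdIter_lt hε hs hη₁ hη₁ε₀
  refine ⟨η, hη, hηε₀, fun A x hA hAc hxA hAS hd y hyA => ?_⟩
  have hy := hguide A x hxA hAS hd y hyA
  obtain ⟨hσ, him⟩ := hsync A y hyA hAS hy
  refine ⟨fun n => (hy n).trans_le hη₁ε₀, ?_⟩
  simp only [him]
  exact hlim A _ hA hAc hσ.continuousOn hσ.gap hσ.gap_close hσ.mem hσ.close

end Core

end

/-! ### Time reversal and adequate pairs. -/

section

variable {M : Type*} [MetricSpace M] {X : Flow ℝ M} {ε δ ρ ε₀ : ℝ} {k : ℕ}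
  {S T : Fin k → Set M}

lemma reverse_apply (X : Flow ℝ M) (t : ℝ) (x : M) : X.reverse t x = X (-t) x := rfl

lemma tube_reverse (X : Flow ℝ M) (r : ℝ) (A : Set M) : tube X.reverse r A = tube X r A := by
  have h : ∀ Y : Flow ℝ M, tube Y.reverse r A ⊆ tube Y r A := by
    rintro Y _ ⟨t, ht, x, hx, rfl⟩
    exact ⟨-t, ⟨by linarith [ht.2], by linarith [ht.1]⟩, x, hx, rfl⟩
  refine (h X).antisymm ?_
  rintro _ ⟨t, ht, x, hx, rfl⟩
  exact ⟨-t, ⟨by linarith [ht.2], by linarith [ht.1]⟩, x, hx, by simp⟩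

/-- Conjugate each reparametrisation by `t ↦ -t`. -/
lemma CWExpansive.reverse (hX : CWExpansive X) : CWExpansive X.reverse := by
  intro e he
  obtain ⟨d, hd, h⟩ := hX e he
  refine ⟨d, hd, fun A hA hAc α p hα hdiam => ?_⟩
  rw [tube_reverse]
  refine h A hA hAc (fun x => ((Homeomorph.neg ℝ).trans (α x)).trans (Homeomorph.neg ℝ)) p
    ⟨fun x => ?_, ?_, fun t => ?_⟩ fun t => ?_
  · simp [hα.map_zero x]
  · ext t
    simp [hα.guide]
  · exact (hα.continuous_eval (-t)).neg
  · simpa [reparamImage, reverse_apply] using hdiam (-t)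

/-- A return from `x` to `X^t(x)` is a return of the reversed flow from `X^t(x)` to `x`. -/
lemma theta_reverse (X : Flow ℝ M) (S : Fin k → Set M) : theta X.reverse S = theta X S := by
  have h : ∀ (Y Z : Flow ℝ M), (∀ t x, Y t (Z t x) = x) → ∀ d : ℝ,
      (∀ x ∈ ⋃ i, S i, ∀ t ∈ Ioo 0 d, Y t x ∉ ⋃ i, S i) →
      ∀ x ∈ ⋃ i, S i, ∀ t ∈ Ioo 0 d, Z t x ∉ ⋃ i, S i := by
    intro Y Z hYZ d hd x hx t ht hxt
    refine hd _ hxt t ht ?_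
    rwa [hYZ]
  unfold theta
  congr 1
  ext d
  refine and_congr_right fun _ => ⟨h _ _ (fun t x => ?_) d, h _ _ (fun t x => ?_) d⟩
  · rw [reverse_apply, ← X.map_add, neg_add_cancel, X.map_zero_apply]
  · rw [reverse_apply, ← X.map_add, add_neg_cancel, X.map_zero_apply]

lemma image2_reverse (X : Flow ℝ M) (a b : ℝ) (A : Set M) :
    image2 (fun t x => X.reverse t x) (Icc a b) A =
      image2 (fun t x => X t x) (Icc (-b) (-a)) A := by
  ext z
  constructor
  · rintro ⟨t, ht, x, hx, rfl⟩
    exact ⟨-t, ⟨by linarith [ht.2], by linarith [ht.1]⟩, x, hx, rfl⟩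
  · rintro ⟨t, ht, x, hx, rfl⟩
    exact ⟨-t, ⟨by linarith [ht.2], by linarith [ht.1]⟩, x, hx, by simp⟩

lemma IsCrossSection.reverse {A : Set M} (h : IsCrossSection X ε A) :
    IsCrossSection X.reverse ε A :=
  ⟨h.isClosed, fun x hx => by rw [tube_reverse, h.inter_eq x hx]⟩

lemma IsAdequatePair.reverse (h : IsAdequatePair X ε δ S T) :
    IsAdequatePair X.reverse ε δ S T where
  time_pos := h.time_pos
  diam_pos := h.diam_pos
  crossS i := (h.crossS i).reverse
  crossT i := (h.crossT i).reverse
  diamS := h.diamS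
  diamT := h.diamT
  subset_interior i := by
    rw [sectionInterior, tube_reverse]
    exact h.subset_interior i
  cover_fwd_T := by simpa only [image2_reverse, neg_zero] using h.cover_bwd_T
  cover_bwd_T := by simpa only [image2_reverse, neg_zero, neg_neg] using h.cover_fwd_T
  cover_fwd_S := by simpa only [image2_reverse, neg_zero] using h.cover_bwd_S
  cover_bwd_S := by simpa only [image2_reverse, neg_zero, neg_neg] using h.cover_fwd_S

lemma IsRadius.reverse (h : IsRadius X ε S ρ) : IsRadius X.reverse ε S ρ :=
  ⟨h.pos, h.lt_time, by rw [theta_reverse]; exact h.lt_theta⟩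

lemma IsSize.reverse (h : IsSize X ε S T ρ ε₀) : IsSize X.reverse ε S T ρ ε₀ :=
  ⟨h.pos, by rw [theta_reverse]; exact h.lt_theta, fun i j x hx y hy hxy t ht hT => by
    rw [tube_reverse]
    exact h.mem_tube i j x hx y hy hxy (-t) (by rwa [abs_neg]) hT⟩

lemma IsAdequatePair.isTransversal (h : IsAdequatePair X ε δ S T) (hρ : IsRadius X ε S ρ) :
    IsTransversal X ε (theta X S) ρ (⋃ i, S i) (⋃ i, T i) where
  isClosed := isClosed_iUnion_of_finite fun i => (h.crossS i).isClosed
  isClosed_sub := isClosed_iUnion_of_finite fun i => (h.crossT i).isClosed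
  subset := iUnion_mono fun i => (h.subset_interior i).trans inter_subset_right
  eq_zero := by
    have key : ∀ x ∈ ⋃ i, S i, ∀ t : ℝ, 0 < t → t < theta X S → X t x ∉ ⋃ i, S i := by
      intro x hx t ht htθ
      have hne : {d : ℝ | 0 < d ∧ ∀ x ∈ ⋃ i, S i, ∀ t ∈ Ioo 0 d, X t x ∉ ⋃ i, S i}.Nonempty := by
        by_contra hemp
        -- With no admissible `d` the supremum is `0`, leaving no `t` with `0 < t < θ`.
        rw [theta, not_nonempty_iff_eq_empty.1 hemp, Real.sSup_empty] at htθ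
        linarith
      obtain ⟨d, hd, htd⟩ := exists_lt_of_lt_csSup hne htθ
      exact hd.2 x hx t ⟨ht, htd⟩
    intro x hx t ht hxt
    rcases lt_trichotomy t 0 with hneg | h0 | hpos
    · rw [abs_of_neg hneg] at ht
      refine absurd ?_ (key _ hxt (-t) (neg_pos.2 hneg) ht)
      rwa [← X.map_add, neg_add_cancel, X.map_zero_apply]
    · exact h0
    · rw [abs_of_pos hpos] at ht
      exact absurd hxt (key x hx t hpos ht)
  pos := hρ.pos
  lt_theta := hρ.lt_theta
  hits x := by
    obtain ⟨i, t, ht, y, hy, rfl⟩ := mem_iUnion.1 (h.cover_bwd_T ▸ mem_univ x)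
    refine ⟨-t, ⟨by linarith [ht.2], by linarith [ht.1]⟩, mem_iUnion.2 ⟨i, ?_⟩⟩
    dsimp only
    rwa [← X.map_add, neg_add_cancel, X.map_zero_apply]

lemma iter_neg_natCast (X : Flow ℝ M) (S T : Fin k → Set M) (ρ : ℝ) (A : Set M) (x : M) (n : ℕ) :
    iter X S T ρ A x (-(n : ℤ)) = fwdIter X.reverse S T ρ A x n := by
  cases n <;> rfl

variable [CompactSpace M]

lemma IsAdequatePair.exists_tendsto_diam_fwdIter (hX : CWExpansive X)
    (hST : IsAdequatePair X ε δ S T) (hρ : IsRadius X ε S ρ) (hε₀ : IsSize X ε S T ρ ε₀) :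
    ∃ η > 0, η ≤ ε₀ ∧ ∀ (A : Set M) (x : M), IsCompact A → IsConnected A → x ∈ A →
      (∃ j, A ⊆ S j) → (∀ n : ℕ, Metric.diam (fwdIter X S T ρ A x n) < η) →
      ∀ y ∈ A, (∀ n : ℕ, Metric.diam (fwdIter X S T ρ A y n) < ε₀) ∧
        Tendsto (fun n : ℕ => Metric.diam (fwdIter X S T ρ A y n)) atTop (𝓝 0) :=
  (hST.isTransversal hρ).exists_tendsto_diam_fwdIter hX hST.time_pos hε₀.pos hε₀.mem_tube

end

end CWFlow

end

/-! ### The theorem, from the forward statement for the flow and its reverse. -/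

theorem mainTheorem4 {M : Type*} [MetricSpace M] [CompactSpace M]
    (X : Flow ℝ M) (hX : CWFlow.CWExpansive X)
    {k : ℕ} (S T : Fin k → Set M) (ε δ : ℝ) (hST : CWFlow.IsAdequatePair X ε δ S T)
    (ρ : ℝ) (hρ : CWFlow.IsRadius X ε S ρ)
    (ε₀ : ℝ) (hε₀ : CWFlow.IsSize X ε S T ρ ε₀) :
    ∃ η₀ : ℝ, 0 < η₀ ∧ η₀ ≤ ε₀ ∧ ∀ η : ℝ, 0 < η → η < η₀ →
      (∀ A ∈ CWFlow.localStable X S T ρ ε₀ η, ∀ x ∈ A,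
        (∀ n : ℤ, 0 ≤ n → CWFlow.IterDefined X S T ρ ε₀ A x n) ∧
        Tendsto (fun n : ℤ => Metric.diam (CWFlow.iter X S T ρ A x n)) atTop (𝓝 0)) ∧
      (∀ A ∈ CWFlow.localUnstable X S T ρ ε₀ η, ∀ x ∈ A,
        (∀ n : ℤ, n ≤ 0 → CWFlow.IterDefined X S T ρ ε₀ A x n) ∧
        Tendsto (fun n : ℤ => Metric.diam (CWFlow.iter X S T ρ A x n)) atBot (𝓝 0)) := by
  obtain ⟨η₁, hη₁, hη₁ε₀, h₁⟩ := hST.exists_tendsto_diam_fwdIter hX hρ hε₀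
  obtain ⟨η₂, hη₂, -, h₂⟩ :=
    hST.reverse.exists_tendsto_diam_fwdIter hX.reverse hρ.reverse hε₀.reverse
  refine ⟨min η₁ η₂, lt_min hη₁ hη₂, (min_le_left _ _).trans hη₁ε₀, fun η _ hη => ⟨?_, ?_⟩⟩
  · rintro A ⟨hA, hAc, x, hxA, hx⟩ y hyA
    have hAS := (hx 0 le_rfl).1.2.1
    obtain ⟨hy, hlim⟩ := h₁ A x hA hAc hxA hAS
      (fun n => (hx n (Int.natCast_nonneg n)).2.trans (hη.trans_le (min_le_left _ _))) y hyA
    refine ⟨fun n hn => ⟨hyA, hAS, fun m hm => ?_⟩, ?_⟩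
    · obtain ⟨j, rfl⟩ := Int.eq_ofNat_of_zero_le (show 0 ≤ m by omega)
      exact hy j
    · rw [← Nat.map_cast_int_atTop, tendsto_map'_iff]
      exact hlim
  · rintro A ⟨hA, hAc, x, hxA, hx⟩ y hyA
    have hAS := (hx 0 le_rfl).1.2.1
    obtain ⟨hy, hlim⟩ := h₂ A x hA hAc hxA hAS
      (fun n => by
        rw [← CWFlow.iter_neg_natCast]
        exact (hx _ (by omega)).2.trans (hη.trans_le (min_le_right _ _))) y hyA
    refine ⟨fun n hn => ⟨hyA, hAS, fun m hm => ?_⟩, ?_⟩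
    · obtain ⟨j, hj⟩ := Int.eq_ofNat_of_zero_le (show 0 ≤ -m by omega)
      rw [show m = -(j : ℤ) by omega, CWFlow.iter_neg_natCast]
      exact hy j
    · rw [← map_neg_atTop, tendsto_map'_iff, ← Nat.map_cast_int_atTop, tendsto_map'_iff]
      refine hlim.congr fun n => ?_
      rw [← CWFlow.iter_neg_natCast]
      rfl
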